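/- Let $q$ be a complex number with $|q|<1$. For $a\in\mathbb{C}$ and an integer $m\ge 0$, and for a base $p\in\mathbb{C}$ with $|p|<1$, write $$(a;p)_m=\prod_{k=0}^{m-1}(1-ap^k),\qquad (a;p)_\infty=\prod_{k=0}^{\infty}(1-ap^k),\qquad (a_1,a_2,a_3;p)_\infty=(a_1;p)_\infty(a_2;p)_\infty(a_3;p)_\infty .$$ Then the following double series converges absolutely, and $$\sum_{n,r\ge 0}\frac{q^{3n^2+4r^2+6nr+9n+12r}\,(q^3;q^3)_r\,(q;q)_{3n+2r+3}}{(q^3;q^3)_{2n+2r+3}\,(q;q)_r\,(q;q)_{2r+2}\,(q^3;q^3)_n}=\frac{(q^3,q^{78},q^{81};q^{81})_\infty}{(q^3;q^3)_\infty}.$$ -/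

import Mathlib

/-- The finite rising `q`-factorial `(a; q)_n = (1 - a)(1 - a q) ⋯ (1 - a q^(n-1))`. -/
noncomputable def qPoch (a q : ℂ) (n : ℕ) : ℂ :=
  ∏ k ∈ Finset.range n, (1 - a * q ^ k)

/-- The infinite rising `q`-factorial `(a; q)_∞ = ∏_{k ≥ 0} (1 - a q^k)`, used for `|q| < 1`. -/
noncomputable def qPochInf (a q : ℂ) : ℂ :=
  ∏' k : ℕ, (1 - a * q ^ k)

/-- The infinite product defining `(a; q)_∞` converges for every `a` when `|q| < 1`. -/
theorem multipliable_qPochInf (a : ℂ) {q : ℂ} (hq : ‖q‖ < 1) :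
    Multipliable fun k : ℕ => 1 - a * q ^ k := by
  have h : Summable fun k : ℕ => ‖-(a * q ^ k)‖ := by
    simp only [norm_neg, norm_mul, norm_pow]
    exact (summable_geometric_of_lt_one (norm_nonneg q) hq).mul_left _
  simpa [sub_eq_add_neg] using multipliable_one_add_of_summable h

/-! The identity is a cubic change of base for Bailey pairs, followed by the Jacobi triple product.
Write `α_m` for `cubicAlpha q m`.

The Bailey pair `sum_cubicAlpha` expands `(q³;q³)_r / ((q;q)_r (q;q)_{2r+2})` as a sum of `α_m /
((q;q)_t (q;q)_{t+2m+3})` over `t + m = r`. With `m` and `s = n + t` fixed, the sum over `n` is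
`sum_cubic` with `k = 2m + 3`, a case of q-Saalschütz at primitive cube roots of unity. Its
numerator cancels `(q³;q³)_{2n+2r+3}`, which depends only on `n + r = s + m`. The sum over `s` is
then Cauchy's `tsum_durfee` in base `q³`, equal to `1/(q³;q³)_∞` for every `m`. What remains is `∑
α_m q^(4m²+12m)`, a theta series supported on `3 ∣ m`, which `tsum_jacobi` turns into the product
with base `q^81`.

All rearrangements are finite: they take place on the antidiagonals `n + r = N`, and absolute
convergence carries them to the double series. -/

/-! ### Finite and infinite `q`-factorials: recurrences, nonvanishing, uniform bounds. -/

open Filter Topology in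
theorem tendsto_qPoch (a : ℂ) {q : ℂ} (hq : ‖q‖ < 1) :
    Tendsto (qPoch a q) atTop (𝓝 (qPochInf a q)) :=
  (multipliable_qPochInf a hq).hasProd.tendsto_prod_nat

@[simp] theorem qPoch_zero (a q : ℂ) : qPoch a q 0 = 1 := by simp [qPoch]

theorem qPoch_succ (a q : ℂ) (n : ℕ) : qPoch a q (n + 1) = qPoch a q n * (1 - a * q ^ n) := by
  simp [qPoch, Finset.prod_range_succ]

theorem qPoch_add (a q : ℂ) (m n : ℕ) :
    qPoch a q (m + n) = qPoch a q m * qPoch (a * q ^ m) q n := by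
  simp only [qPoch, Finset.prod_range_add, pow_add, mul_assoc]

theorem qPoch_succ_left (a q : ℂ) (n : ℕ) :
    qPoch a q (n + 1) = (1 - a) * qPoch (a * q) q n := by
  rw [add_comm n 1, qPoch_add]; simp [qPoch_succ]

theorem one_sub_pow_succ_ne_zero {q : ℂ} (hq : ‖q‖ < 1) (n : ℕ) : 1 - q ^ (n + 1) ≠ 0 := by
  intro h
  have h1 : ‖q ^ (n + 1)‖ < 1 := by
    rw [norm_pow]; exact pow_lt_one₀ (norm_nonneg q) hq (by omega)
  rw [← sub_eq_zero.mp h] at h1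
  simp at h1

theorem qPoch_self_succ (q : ℂ) (n : ℕ) : qPoch q q (n + 1) = qPoch q q n * (1 - q ^ (n + 1)) := by
  rw [qPoch_succ, pow_succ']

theorem qPoch_self_ne_zero {q : ℂ} (hq : ‖q‖ < 1) (n : ℕ) : qPoch q q n ≠ 0 := by
  induction n with
  | zero => simp
  | succ n ih => rw [qPoch_self_succ]; exact mul_ne_zero ih (one_sub_pow_succ_ne_zero hq n)

/-- `(q; q)_{m+n} = (q; q)_m (q^{m+1}; q)_n`. -/
theorem qPoch_self_add (q : ℂ) (m n : ℕ) :
    qPoch q q (m + n) = qPoch q q m * qPoch (q ^ (m + 1)) q n := by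
  rw [qPoch_add, pow_succ']

theorem qPochInf_self_ne_zero {q : ℂ} (hq : ‖q‖ < 1) : qPochInf q q ≠ 0 := by
  have h := tprod_one_add_ne_zero_of_summable (f := fun k : ℕ => -(q * q ^ k)) (R := ℂ)
    (fun k => by
      rw [← sub_eq_add_neg, ← pow_succ']; exact one_sub_pow_succ_ne_zero hq k)
    (by
      simp only [norm_neg, norm_mul, norm_pow]
      exact (summable_geometric_of_lt_one (norm_nonneg q) hq).mul_left _)
  simpa [qPochInf, sub_eq_add_neg] using h

theorem exists_norm_le_of_tendsto {u : ℕ → ℂ} {l : ℂ}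
    (h : Filter.Tendsto u Filter.atTop (nhds l)) : ∃ K : ℝ, 0 < K ∧ ∀ n, ‖u n‖ ≤ K := by
  obtain ⟨K, hK⟩ := (Metric.isBounded_range_of_tendsto u h).exists_norm_le
  exact ⟨max K 1, by positivity, fun n => (hK _ ⟨n, rfl⟩).trans (le_max_left _ _)⟩

theorem exists_norm_qPoch_le (a : ℂ) {q : ℂ} (hq : ‖q‖ < 1) :
    ∃ K : ℝ, 0 < K ∧ ∀ n, ‖qPoch a q n‖ ≤ K :=
  exists_norm_le_of_tendsto (tendsto_qPoch a hq)

theorem exists_norm_inv_qPoch_le {q : ℂ} (hq : ‖q‖ < 1) :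
    ∃ K : ℝ, 0 < K ∧ ∀ n, ‖(qPoch q q n)⁻¹‖ ≤ K :=
  exists_norm_le_of_tendsto ((tendsto_qPoch q hq).inv₀ (qPochInf_self_ne_zero hq))

/-! ### Sums over antidiagonals. -/

open Finset in
/-- Shifting one index into the other along antidiagonals. -/
theorem sum_antidiagonal_shift {f g : ℕ → ℕ → ℂ} (hf : ∀ i, f i 0 = 0) (hg : ∀ j, g 0 j = 0)
    (n : ℕ) (h : ∀ i j, i + j + 1 = n → f i (j + 1) = g (i + 1) j) :
    ∑ p ∈ antidiagonal n, f p.1 p.2 = ∑ p ∈ antidiagonal n, g p.1 p.2 := by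
  cases n with
  | zero => simp [hf, hg]
  | succ n =>
    rw [Nat.sum_antidiagonal_succ' (f := fun p => f p.1 p.2),
      Nat.sum_antidiagonal_succ (f := fun p => g p.1 p.2)]
    simp only [hf, hg, zero_add]
    exact sum_congr rfl fun p hp => h _ _ (by rw [mem_antidiagonal.mp hp])

-- Both sides run over all triples of sum `N`. Regrouping `n + (t + m)` as `(n + t) + m` is the
-- interchange of summation behind the change of base.
open Finset in
theorem sum_antidiagonal_assoc (F : ℕ → ℕ → ℕ → ℂ) (N : ℕ) :
    ∑ p ∈ antidiagonal N, ∑ x ∈ antidiagonal p.2, F p.1 x.1 x.2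
      = ∑ p ∈ antidiagonal N, ∑ x ∈ antidiagonal p.1, F x.1 x.2 p.2 := by
  rw [sum_sigma', sum_sigma']
  refine sum_nbij' (fun z => ⟨(z.1.1 + z.2.1, z.2.2), (z.1.1, z.2.1)⟩)
    (fun z => ⟨(z.2.1, z.2.2 + z.1.2), (z.2.2, z.1.2)⟩) ?_ ?_ ?_ ?_ ?_
  · rintro ⟨⟨a, b⟩, ⟨c, d⟩⟩ h; simp at h ⊢; omega
  · rintro ⟨⟨a, b⟩, ⟨c, d⟩⟩ h; simp at h ⊢; omega
  · rintro ⟨⟨a, b⟩, ⟨c, d⟩⟩ h; simp at h ⊢; omega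
  · rintro ⟨⟨a, b⟩, ⟨c, d⟩⟩ h; simp at h ⊢; omega
  · rintro ⟨⟨a, b⟩, ⟨c, d⟩⟩ h; rfl

open Finset in
theorem tsum_eq_of_sum_antidiagonal_eq {f g : ℕ × ℕ → ℂ} (hf : Summable f) (hg : Summable g)
    (h : ∀ n, ∑ p ∈ antidiagonal n, f p = ∑ p ∈ antidiagonal n, g p) :
    ∑' p, f p = ∑' p, g p := by
  have key : ∀ {f : ℕ × ℕ → ℂ}, Summable f → ∑' p, f p = ∑' n, ∑ p ∈ antidiagonal n, f p := by
    intro f hf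
    rw [← HasAntidiagonal.sigmaAntidiagonalEquivProd.tsum_eq f]
    refine (Summable.tsum_sigma' (fun n => (hasSum_fintype _).summable)
      (HasAntidiagonal.sigmaAntidiagonalEquivProd.summable_iff.mpr hf)).trans ?_
    refine tsum_congr fun n => ?_
    rw [tsum_fintype]
    exact sum_coe_sort (antidiagonal n) f
  rw [key hf, key hg]
  exact tsum_congr h

theorem summable_prod_of_norm_le_pow {f : ℕ × ℕ → ℂ} {C r : ℝ} (hr0 : 0 ≤ r) (hr : r < 1)
    (h : ∀ p, ‖f p‖ ≤ C * r ^ (p.1 + p.2)) : Summable f := by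
  have hs := summable_geometric_of_lt_one hr0 hr
  have := (hs.mul_of_nonneg hs (fun _ => by positivity) (fun _ => by positivity)).mul_left C
  refine .of_norm_bounded this fun p => ?_
  rw [← pow_add]; exact h p

/-! ### The `q`-binomial and `q`-Saalschütz sums. -/

theorem two_mul_choose_two (n : ℕ) : 2 * n.choose 2 + n = n * n := by
  induction n with
  | zero => simp
  | succ n ih => rw [Nat.choose_succ_succ' n 1, Nat.choose_one_right]; nlinarith

open Finset in
/-- The finite `q`-binomial theorem. -/
theorem sum_qBinomial {q : ℂ} (hq : ‖q‖ < 1) (N : ℕ) (z : ℂ) :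
    ∑ p ∈ antidiagonal N, (-1) ^ p.1 * z ^ p.1 * q ^ p.1.choose 2
        / (qPoch q q p.1 * qPoch q q p.2) = qPoch z q N / qPoch q q N := by
  induction N generalizing z with
  | zero => simp
  | succ N ih =>
    have hN := one_sub_pow_succ_ne_zero hq N
    have hP := qPoch_self_ne_zero hq
    rw [qPoch_succ_left, qPoch_self_succ, ← mul_right_inj' hN]
    -- For `i + j = N + 1`, `1 - q^(N+1) = q^i (1 - q^j) + (1 - q^i)`. Each piece lowers one index
    -- and replaces `z` by `z q`, hence the induction over all `z`.
    have hsplit : ∀ p ∈ antidiagonal (N + 1),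
        (1 - q ^ (N + 1)) * ((-1) ^ p.1 * z ^ p.1 * q ^ p.1.choose 2
          / (qPoch q q p.1 * qPoch q q p.2))
        = (q ^ p.1 * (1 - q ^ p.2)) * ((-1) ^ p.1 * z ^ p.1 * q ^ p.1.choose 2
          / (qPoch q q p.1 * qPoch q q p.2))
        + (1 - q ^ p.1) * ((-1) ^ p.1 * z ^ p.1 * q ^ p.1.choose 2
          / (qPoch q q p.1 * qPoch q q p.2)) := by
      intro p hp
      rw [← mem_antidiagonal.mp hp, pow_add]; ring
    rw [mul_sum, sum_congr rfl hsplit, sum_add_distrib, Nat.sum_antidiagonal_succ',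
      Nat.sum_antidiagonal_succ (f := fun p => (1 - q ^ p.1) * _)]
    have h1 : ∀ p ∈ antidiagonal N, (q ^ p.1 * (1 - q ^ (p.2 + 1))) *
          ((-1) ^ p.1 * z ^ p.1 * q ^ p.1.choose 2 / (qPoch q q p.1 * qPoch q q (p.2 + 1)))
        = (-1) ^ p.1 * (z * q) ^ p.1 * q ^ p.1.choose 2 / (qPoch q q p.1 * qPoch q q p.2) := by
      intro p _
      have := one_sub_pow_succ_ne_zero hq p.2
      have := hP p.1
      have := hP p.2
      rw [qPoch_self_succ, mul_pow]; field_simp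
    have h2 : ∀ p ∈ antidiagonal N, (1 - q ^ (p.1 + 1)) *
          ((-1) ^ (p.1 + 1) * z ^ (p.1 + 1) * q ^ (p.1 + 1).choose 2
            / (qPoch q q (p.1 + 1) * qPoch q q p.2))
        = -z * ((-1) ^ p.1 * (z * q) ^ p.1 * q ^ p.1.choose 2
            / (qPoch q q p.1 * qPoch q q p.2)) := by
      intro p _
      have := one_sub_pow_succ_ne_zero hq p.1
      have := hP p.1
      have := hP p.2
      have hch : q ^ (p.1 + 1).choose 2 = q ^ p.1 * q ^ p.1.choose 2 := by
        rw [Nat.choose_succ_succ' p.1 1, Nat.choose_one_right, pow_add]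
      rw [qPoch_self_succ, mul_pow, hch, pow_succ (-1 : ℂ), pow_succ z]
      field_simp
    rw [sum_congr rfl h1, sum_congr rfl h2, ← mul_sum, ih]
    have := hP N
    simp
    field_simp
    ring

open Finset in
/-- The `q`-Pfaff–Saalschütz summation. -/
theorem sum_qSaalschutz {q : ℂ} (hq : ‖q‖ < 1) {a b c e : ℂ} (habe : c = a * b * e)
    (hc : ∀ k : ℕ, 1 - c * q ^ k ≠ 0) (n : ℕ) :
    ∑ p ∈ antidiagonal n, qPoch a q p.1 * qPoch b q p.1 * qPoch e q p.2 * e ^ p.1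
        / (qPoch q q p.1 * qPoch q q p.2 * qPoch c q p.1)
      = qPoch (a * e) q n * qPoch (b * e) q n / (qPoch q q n * qPoch c q n) := by
  have hP := qPoch_self_ne_zero hq
  have hC : ∀ k, qPoch c q k ≠ 0 := fun k => by
    induction k with
    | zero => simp
    | succ k ih => rw [qPoch_succ]; exact mul_ne_zero ih (hc k)
  set F : ℕ → ℕ → ℂ := fun i j => qPoch a q i * qPoch b q i * qPoch e q j * e ^ i
        / (qPoch q q i * qPoch q q j * qPoch c q i) with hF
  change ∑ p ∈ antidiagonal n, F p.1 p.2 = _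
  induction n with
  | zero => simp [hF]
  | succ n ih =>
    have hn := one_sub_pow_succ_ne_zero hq n
    have hcn := hc n
    -- The first-order recurrence satisfied by the closed form on the right.
    have hrec : (1 - q ^ (n + 1)) * (1 - c * q ^ n)
          * ∑ p ∈ antidiagonal (n + 1), F p.1 p.2
        = (1 - a * e * q ^ n) * (1 - b * e * q ^ n) * ∑ p ∈ antidiagonal n, F p.1 p.2 := by
      have hsplit : ∀ p ∈ antidiagonal (n + 1), (1 - q ^ (n + 1)) * F p.1 p.2
          = (1 - q ^ p.2) * F p.1 p.2 + (q ^ p.2 * (1 - q ^ p.1)) * F p.1 p.2 := by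
        intro p hp
        rw [← mem_antidiagonal.mp hp, pow_add]; ring
      have h1 : ∀ i j, (1 - q ^ (j + 1)) * F i (j + 1) = (1 - e * q ^ j) * F i j := by
        intro i j
        have := one_sub_pow_succ_ne_zero hq j
        have := hP i
        have := hP j
        have := hC i
        simp only [hF, qPoch_self_succ, qPoch_succ e]; field_simp
      have h2 : ∀ i j, (1 - q ^ (i + 1)) * (1 - c * q ^ i) * F (i + 1) j
          = (1 - a * q ^ i) * (1 - b * q ^ i) * e * F i j := by
        intro i j
        have := one_sub_pow_succ_ne_zero hq i
        have := hP i
        have := hP j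
        have := hC i
        have := hc i
        simp only [hF, qPoch_self_succ, qPoch_succ a, qPoch_succ b, qPoch_succ c, pow_succ e]
        field_simp
      -- The telescoping certificate: by `h1` and `h2`, both `f i (j+1)` and `g (i+1) j` equal `c
      -- q^n (1 - q^(i+1)) (1 - q^(j+1)) F (i+1) (j+1)`. The two sides of the recurrence differ
      -- termwise by `f - g`.
      have htel := sum_antidiagonal_shift (n := n)
        (f := fun i j => c * q ^ n * ((1 - q ^ j) * ((1 - a * q ^ i) * (1 - b * q ^ i) * e
          * F i j) / (1 - c * q ^ i)))
        (g := fun i j => c * q ^ n * ((1 - q ^ i) * (1 - e * q ^ j) * F i j))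
        (by simp) (by simp) (by
          intro i j _
          have := hc i
          have := one_sub_pow_succ_ne_zero hq j
          have e1 := h1 i j
          have e2 := h2 i j
          rw [mul_left_comm (1 - q ^ (j + 1)), e1]
          have e3 : (1 - q ^ (i + 1)) * F (i + 1) j
              = (1 - a * q ^ i) * (1 - b * q ^ i) * e * F i j / (1 - c * q ^ i) := by
            rw [eq_div_iff (by assumption), ← e2]; ring
          rw [mul_right_comm (1 - q ^ (i + 1)), e3]
          ring)
      rw [mul_right_comm, mul_sum, sum_congr rfl hsplit, sum_add_distrib, Nat.sum_antidiagonal_succ',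
        Nat.sum_antidiagonal_succ (f := fun p => (q ^ p.2 * (1 - q ^ p.1)) * _)]
      simp only [pow_zero, sub_self, zero_mul, mul_zero, zero_add, h1]
      rw [← sum_add_distrib, sum_mul, mul_sum, ← sub_eq_zero, ← sum_sub_distrib]
      rw [← sub_eq_zero, ← sum_sub_distrib] at htel
      rw [← htel]
      refine sum_congr rfl fun p hp => ?_
      have := hc p.1
      have e2 := h2 p.1 p.2
      have hpn : q ^ n = q ^ p.1 * q ^ p.2 := by rw [← mem_antidiagonal.mp hp, pow_add]
      have e3 : q ^ p.2 * (1 - q ^ (p.1 + 1)) * F (p.1 + 1) p.2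
          = q ^ p.2 * ((1 - a * q ^ p.1) * (1 - b * q ^ p.1) * e * F p.1 p.2)
            / (1 - c * q ^ p.1) := by
        rw [eq_div_iff this]; linear_combination q ^ p.2 * e2
      rw [e3, hpn]
      generalize hD : 1 - c * q ^ p.1 = D at *
      field_simp
      rw [← hD, habe]
      ring
    rw [ih] at hrec
    rw [qPoch_succ, qPoch_succ (b * e), qPoch_succ c, qPoch_self_succ]
    have := hP n
    have := hC n
    rw [mul_comm, ← eq_div_iff (mul_ne_zero hn hcn)] at hrec
    rw [hrec]
    field_simp

/-! ### The cubic summation, from cube roots of unity. -/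

theorem norm_pow_lt_one {q : ℂ} (hq : ‖q‖ < 1) {n : ℕ} (hn : n ≠ 0) : ‖q ^ n‖ < 1 := by
  rw [norm_pow]; exact pow_lt_one₀ (norm_nonneg q) hq hn

theorem exists_sq_add_self_add_one : ∃ ω : ℂ, ω ^ 2 + ω + 1 = 0 := by
  obtain ⟨s, hs⟩ := IsAlgClosed.exists_pow_nat_eq (-3 : ℂ) two_pos
  exact ⟨(-1 + s) / 2, by linear_combination hs / 4⟩

theorem pow_three_of_sq_add {ω : ℂ} (hω : ω ^ 2 + ω + 1 = 0) : ω ^ 3 = 1 := by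
  linear_combination (ω - 1) * hω

/-- Factor by factor, `(1 - y)(1 - ωy)(1 - ω²y) = 1 - y³`; this is how base `q³` enters. -/
theorem qPoch_mul_cube_roots {ω : ℂ} (hω : ω ^ 2 + ω + 1 = 0) (a q : ℂ) (n : ℕ) :
    qPoch a q n * (qPoch (ω * a) q n * qPoch (ω ^ 2 * a) q n) = qPoch (a ^ 3) (q ^ 3) n := by
  simp only [qPoch, ← Finset.prod_mul_distrib]
  refine Finset.prod_congr rfl fun k _ => ?_
  have hω3 := pow_three_of_sq_add hω
  linear_combination (-(a * q ^ k) + ω * (a * q ^ k) ^ 2) * hω - (a * q ^ k) ^ 3 * hω3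

/-- Reversal of the product `(ω q^{-M}; q)_i (ω² q^{-M}; q)_i`. -/
theorem qPoch_cube_roots_neg_pow {ω : ℂ} (hω : ω ^ 2 + ω + 1 = 0) {q : ℂ} (hq : ‖q‖ < 1)
    (hq0 : q ≠ 0) (i j : ℕ) :
    qPoch (ω * (q ^ (i + j))⁻¹) q i * qPoch (ω ^ 2 * (q ^ (i + j))⁻¹) q i
        * q ^ ((2 * (i + j) + 1) * i) * (qPoch q q (i + j) * qPoch (q ^ 3) (q ^ 3) j)
      = q ^ (i ^ 2) * (qPoch (q ^ 3) (q ^ 3) (i + j) * qPoch q q j) := by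
  induction i generalizing j with
  | zero => simp; ring
  | succ i ih =>
    -- Using `j + 1` keeps `i + j` fixed, so the parameters `ω q^{-M}` and `ω² q^{-M}` do not
    -- change.
    have h := ih (j + 1)
    rw [show i + (j + 1) = i + 1 + j by ring] at h
    have hu := one_sub_pow_succ_ne_zero hq j
    have hx : (q ^ (i + 1 + j))⁻¹ * q ^ i = (q ^ (j + 1))⁻¹ := by
      rw [show i + 1 + j = i + (j + 1) by ring, pow_add]
      field_simp
    rw [qPoch_succ, qPoch_succ (ω ^ 2 * _), mul_assoc ω, mul_assoc (ω ^ 2), hx]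
    rw [qPoch_self_succ, qPoch_self_succ, pow_right_comm] at h
    have e1 : (2 * (i + 1 + j) + 1) * (i + 1)
        = (2 * (i + 1 + j) + 1) * i + (2 * i + 1) + (j + 1) + (j + 1) := by ring
    have e2 : (i + 1) ^ 2 = i ^ 2 + (2 * i + 1) := by ring
    rw [e1, e2, pow_add _ _ (j + 1), pow_add _ _ (j + 1), pow_add _ _ (2 * i + 1),
      pow_add _ _ (2 * i + 1)]
    have hqj : q ^ (j + 1) ≠ 0 := pow_ne_zero _ hq0
    generalize q ^ (j + 1) = u at *
    generalize qPoch (ω * (q ^ (i + 1 + j))⁻¹) q i = A at *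
    generalize qPoch (ω ^ 2 * (q ^ (i + 1 + j))⁻¹) q i = B at *
    generalize q ^ ((2 * (i + 1 + j) + 1) * i) = X at *
    have hω3 := pow_three_of_sq_add hω
    have hf : (1 - ω * u⁻¹) * (1 - ω ^ 2 * u⁻¹) * (u * u) * (1 - u) = 1 - u ^ 3 := by
      field_simp
      linear_combination (u ^ 2 - u) * hω + (1 - u) * hω3
    rw [← mul_left_inj' hu]
    linear_combination q ^ (2 * i + 1) * h + A * B * X * q ^ (2 * i + 1)
      * qPoch q q (i + 1 + j) * qPoch (q ^ 3) (q ^ 3) j * hf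

open Finset in
/-- The terminating cubic summation underlying the cubic change of base for Bailey pairs. -/
theorem sum_cubic {q : ℂ} (hq : ‖q‖ < 1) (hq0 : q ≠ 0) (k M : ℕ) :
    ∑ p ∈ antidiagonal M, q ^ (p.2 ^ 2 + k * p.2) * qPoch q q (3 * p.1 + 2 * p.2 + k)
        / (qPoch (q ^ 3) (q ^ 3) p.1 * qPoch q q p.2 * qPoch q q (p.2 + k))
      = qPoch (q ^ 3) (q ^ 3) (2 * M + k)
        / (qPoch (q ^ 3) (q ^ 3) M * qPoch (q ^ 3) (q ^ 3) (M + k)) := by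
  obtain ⟨ω, hω⟩ := exists_sq_add_self_add_one
  have hω3 := pow_three_of_sq_add hω
  have hP := qPoch_self_ne_zero hq
  have hQ := qPoch_self_ne_zero (norm_pow_lt_one hq three_ne_zero)
  have hqM : q ^ M ≠ 0 := pow_ne_zero _ hq0
  -- Since `ω³ = 1`, `a b = q^{-2M}`, and `c = a b e` forces this `e`. The products in `a, b` and in
  -- `ae, be` become quotients of base `q³` by base `q` factorials.
  have key := sum_qSaalschutz hq (a := ω * (q ^ M)⁻¹) (b := ω ^ 2 * (q ^ M)⁻¹)
    (c := q ^ (k + 1)) (e := q ^ (k + 2 * M + 1))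
    (by
      rw [show k + 2 * M + 1 = (k + 1) + M + M by ring, pow_add _ _ M,
        pow_add _ _ M]
      field_simp
      linear_combination -hω3)
    (fun l => by
      rw [← pow_add, show k + 1 + l = k + l + 1 by ring]; exact one_sub_pow_succ_ne_zero hq _) M
  have hc : ∀ i, qPoch (q ^ (k + 1)) q i = qPoch q q (k + i) / qPoch q q k := fun i => by
    rw [qPoch_self_add, mul_div_cancel_left₀ _ (hP k)]
  have he : ∀ i, qPoch (q ^ (k + 2 * M + 1)) q i
      = qPoch q q (k + 2 * M + i) / qPoch q q (k + 2 * M) := fun i => by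
    rw [qPoch_self_add, mul_div_cancel_left₀ _ (hP _)]
  have hae : ∀ x : ℂ, x * (q ^ M)⁻¹ * q ^ (k + 2 * M + 1) = x * q ^ (k + M + 1) := fun x => by
    rw [show k + 2 * M + 1 = (k + M + 1) + M by ring, pow_add]; field_simp
  have hR := qPoch_mul_cube_roots hω (q ^ (k + M + 1)) q M
  have hR1 := qPoch_self_add q (k + M) M
  have hR2 := qPoch_self_add (q ^ 3) (k + M) M
  rw [← pow_mul, mul_comm (k + M + 1) 3, pow_mul] at hR
  rw [← hR] at hR2
  rw [hae, hae, hc] at key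
  have hterm : ∀ p ∈ antidiagonal M,
      qPoch (ω * (q ^ M)⁻¹) q p.1 * qPoch (ω ^ 2 * (q ^ M)⁻¹) q p.1
        * qPoch (q ^ (k + 2 * M + 1)) q p.2 * (q ^ (k + 2 * M + 1)) ^ p.1
        / (qPoch q q p.1 * qPoch q q p.2 * qPoch (q ^ (k + 1)) q p.1)
      = qPoch (q ^ 3) (q ^ 3) M * qPoch q q k / (qPoch q q M * qPoch q q (k + 2 * M))
        * (q ^ (p.1 ^ 2 + k * p.1) * qPoch q q (3 * p.2 + 2 * p.1 + k)
        / (qPoch (q ^ 3) (q ^ 3) p.2 * qPoch q q p.1 * qPoch q q (p.1 + k))) := by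
    intro p hp
    have hM := mem_antidiagonal.mp hp
    have h := qPoch_cube_roots_neg_pow hω hq hq0 p.1 p.2
    rw [hM] at h
    rw [hc, he, ← pow_mul, show (k + 2 * M + 1) * p.1 = k * p.1 + (2 * M + 1) * p.1 by ring,
      pow_add, pow_add, show k + 2 * M + p.2 = 3 * p.2 + 2 * p.1 + k by omega, add_comm k p.1]
    generalize qPoch (ω * (q ^ M)⁻¹) q p.1 = A at *
    generalize qPoch (ω ^ 2 * (q ^ M)⁻¹) q p.1 = B at *
    generalize q ^ ((2 * M + 1) * p.1) = X at *
    have := hP M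
    have := hP k
    have := hP p.1
    have := hP p.2
    have := hP (k + 2 * M)
    have := hP (p.1 + k)
    have := hQ p.2
    field_simp
    linear_combination qPoch q q (3 * p.2 + 2 * p.1 + k) * h
  rw [sum_congr rfl hterm, ← mul_sum] at key
  rw [← Nat.sum_antidiagonal_swap]
  simp only [Prod.fst_swap, Prod.snd_swap]
  have h1 := hP M
  have h2 := hP k
  have h3 := hP (k + 2 * M)
  have h4 := hP (k + M)
  have h5 := hQ M
  have h6 := hQ (k + M)
  rw [show k + M + M = 2 * M + k by ring] at hR1 hR2
  rw [add_comm k (2 * M)] at h3 key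
  rw [mul_comm, ← eq_div_iff (div_ne_zero (mul_ne_zero h5 h2) (mul_ne_zero h1 h3))] at key
  rw [key, add_comm M k, hR2, hR1]
  have h7 : qPoch (q ^ (k + M + 1)) q M ≠ 0 := by
    have := hR1 ▸ h3
    exact right_ne_zero_of_mul this
  field_simp

/-! ### The finite triple product and the cubic Bailey pair. -/

/-- The factors of `(x q^{-n}; q)_n` are `1 - x q^{-k} = -x q^{-k} (1 - q^k x⁻¹)` for `1 ≤ k ≤ n`.
-/
theorem qPoch_mul_inv_pow {q x : ℂ} (hq0 : q ≠ 0) (hx : x ≠ 0) (n : ℕ) :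
    (-1) ^ n * (x⁻¹) ^ n * q ^ (n + 1).choose 2 * qPoch (x * (q ^ n)⁻¹) q n
      = qPoch (q * x⁻¹) q n := by
  have h1 : ∀ n, qPoch (x * (q ^ n)⁻¹) q n = ∏ k ∈ Finset.range n, (1 - x * (q ^ (k + 1))⁻¹) := by
    intro n
    rw [qPoch, ← Finset.prod_range_reflect]
    refine Finset.prod_congr rfl fun k hk => ?_
    obtain ⟨l, rfl⟩ := Nat.exists_eq_add_of_lt (Finset.mem_range.mp hk)
    rw [show k + l + 1 - 1 - k = l by omega, show k + l + 1 = (k + 1) + l by ring, pow_add q (k + 1)]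
    field_simp
  rw [h1]
  induction n with
  | zero => simp
  | succ n ih =>
    rw [Finset.prod_range_succ, qPoch_succ, ← ih, show (n + 1 + 1).choose 2 = (n + 1) + (n + 1).choose 2 by
        rw [Nat.choose_succ_succ' (n + 1) 1, Nat.choose_one_right],
      pow_add q (n + 1), pow_succ q n, pow_succ (-1 : ℂ), pow_succ x⁻¹]
    generalize ∏ k ∈ Finset.range n, (1 - x * (q ^ (k + 1))⁻¹) = A
    have : q ^ n ≠ 0 := pow_ne_zero _ hq0
    field_simp
    ring

open Finset in
/-- A finite form of the Jacobi triple product, folded about its centre. -/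
theorem sum_finite_jacobi {q x : ℂ} (hq : ‖q‖ < 1) (hq0 : q ≠ 0) (hx : x ≠ 0) (n d : ℕ) :
    ∑ m ∈ range (n + 1), (-1) ^ m * (x⁻¹) ^ m * q ^ (m + 1).choose 2
          / (qPoch q q (n - m) * qPoch q q (n + m + d + 1))
      + ∑ m ∈ range (n + d + 1), (-1) ^ (m + 1) * x ^ (m + 1) * q ^ (m + 1).choose 2
          / (qPoch q q (n + m + 1) * qPoch q q (n + d - m))
      = qPoch x q (n + d + 1) * qPoch (q * x⁻¹) q n / qPoch q q (2 * n + d + 1) := by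
  have hqn : q ^ n ≠ 0 := pow_ne_zero _ hq0
  -- The shift by `q^{-n}` centres the sum at index `n`. Indices up to `n` are read backwards as `n
  -- - m`, the others as `n + 1 + m`.
  have key := sum_qBinomial hq (2 * n + d + 1) (x * (q ^ n)⁻¹)
  rw [Nat.sum_antidiagonal_eq_sum_range_succ_mk,
    show (2 * n + d + 1).succ = (n + 1) + (n + d + 1) by omega, sum_range_add,
    ← sum_range_reflect, show 2 * n + d + 1 = n + (n + d + 1) by ring, qPoch_add (x * _),
    mul_assoc x, inv_mul_cancel₀ hqn, mul_one] at key
  rw [← qPoch_mul_inv_pow hq0 hx n, show 2 * n + d + 1 = n + (n + d + 1) by ring]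
  have key2 := congrArg (fun t => (-1) ^ n * (x⁻¹) ^ n * q ^ (n + 1).choose 2 * t) key
  simp only [mul_add, mul_sum] at key2
  refine Eq.trans ?_ (key2.trans (by ring))
  have hexp : ∀ l m : ℕ, (l + m + 1).choose 2 + l.choose 2 = (l + m) * l + (m + 1).choose 2 := by
    intro l m
    have := two_mul_choose_two (l + m + 1)
    have := two_mul_choose_two l
    have := two_mul_choose_two (m + 1)
    nlinarith
  have hexp2 : ∀ m : ℕ, (n + 1).choose 2 + (n + 1 + m).choose 2
      = n * (n + 1 + m) + (m + 1).choose 2 := by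
    intro m
    have := two_mul_choose_two (n + 1)
    have := two_mul_choose_two (n + 1 + m)
    have := two_mul_choose_two (m + 1)
    nlinarith
  congr 1
  · refine sum_congr rfl fun m hm => ?_
    obtain ⟨l, rfl⟩ := Nat.exists_eq_add_of_le' (Nat.lt_succ_iff.mp (mem_range.mp hm))
    rw [show l + m + 1 - 1 - m = l by omega, show l + m - m = l by omega,
      show l + m + (l + m + d + 1) - l = l + m + m + d + 1 by omega]
    have hs : (-1 : ℂ) ^ (l + m) * (-1) ^ l = (-1) ^ m := by
      rw [pow_add, mul_right_comm, ← pow_add, Even.neg_one_pow ⟨l, rfl⟩, one_mul]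
    have hqe : q ^ (l + m + 1).choose 2 * q ^ l.choose 2
        = (q ^ (l + m)) ^ l * q ^ (m + 1).choose 2 := by
      rw [← pow_add, hexp, pow_add, pow_mul]
    have hxe : x⁻¹ ^ (l + m) * x ^ l = x⁻¹ ^ m := by
      rw [pow_add, mul_right_comm, ← mul_pow, inv_mul_cancel₀ hx, one_pow, one_mul]
    have hcan : (q ^ (l + m)) ^ l * ((q ^ (l + m))⁻¹) ^ l = 1 := by
      rw [← mul_pow, mul_inv_cancel₀ hqn, one_pow]
    rw [← hs, ← hxe, mul_pow x, ← mul_div_assoc]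
    congr 1
    generalize x⁻¹ ^ (l + m) = y at *
    generalize ((q ^ (l + m))⁻¹) ^ l = w at *
    linear_combination (-(-1) ^ (l + m) * (-1) ^ l * y * x ^ l * w) * hqe
      - (-1) ^ (l + m) * (-1) ^ l * y * x ^ l * q ^ (m + 1).choose 2 * hcan
  · refine sum_congr rfl fun m hm => ?_
    rw [show n + 1 + m = n + m + 1 by ring] at *
    rw [show n + (n + d + 1) - (n + m + 1) = n + d - m by omega]
    have hs : (-1 : ℂ) ^ n * (-1) ^ (n + m + 1) = (-1) ^ (m + 1) := by
      rw [add_assoc, pow_add _ n, ← mul_assoc, ← pow_add, Even.neg_one_pow ⟨n, rfl⟩, one_mul]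
    have hqe : q ^ (n + 1).choose 2 * q ^ (n + m + 1).choose 2
        = (q ^ n) ^ (n + m + 1) * q ^ (m + 1).choose 2 := by
      rw [← pow_add, ← pow_mul, ← pow_add, show n + m + 1 = n + 1 + m by ring, hexp2]
    have hxe : x⁻¹ ^ n * x ^ (n + m + 1) = x ^ (m + 1) := by
      rw [add_assoc, pow_add _ n, ← mul_assoc, ← mul_pow, inv_mul_cancel₀ hx, one_pow, one_mul]
    have hcan : (q ^ n) ^ (n + m + 1) * ((q ^ n)⁻¹) ^ (n + m + 1) = 1 := by
      rw [← mul_pow, mul_inv_cancel₀ hqn, one_pow]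
    rw [← hs, ← hxe, mul_pow x, ← mul_div_assoc]
    congr 1
    generalize x⁻¹ ^ n = y at *
    generalize ((q ^ n)⁻¹) ^ (n + m + 1) = w at *
    linear_combination (-(-1) ^ n * (-1) ^ (n + m + 1) * y * x ^ (n + m + 1) * w) * hqe
      - (-1) ^ n * (-1) ^ (n + m + 1) * y * x ^ (n + m + 1) * q ^ (m + 1).choose 2 * hcan

/-- The `α`-sequence of Dyson's cubic Bailey pair relative to `q ^ 3`, up to normalization. -/
noncomputable def cubicAlpha (q : ℂ) (m : ℕ) : ℂ :=
  if 3 ∣ m then (-1) ^ m * q ^ (m + 1).choose 2 * (1 - q ^ (2 * m + 3)) else 0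

theorem one_add_cube_root_pow {ω : ℂ} (hω : ω ^ 2 + ω + 1 = 0) (m : ℕ) :
    1 + ω ^ m + (ω ^ 2) ^ m = if 3 ∣ m then 3 else 0 := by
  have h3 := pow_three_of_sq_add hω
  obtain ⟨k, r, hr, rfl⟩ : ∃ k r, r < 3 ∧ m = 3 * k + r :=
    ⟨m / 3, m % 3, Nat.mod_lt _ (by norm_num), (Nat.div_add_mod m 3).symm⟩
  have e : (ω ^ 2) ^ 3 = 1 := by rw [← pow_mul, mul_comm, pow_mul, h3, one_pow]
  rw [pow_add, pow_add, pow_mul, h3, pow_mul, e, one_pow, one_mul, one_mul]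
  interval_cases r
  · norm_num
  · rw [if_neg (by omega)]; linear_combination hω
  · rw [if_neg (by omega)]; linear_combination hω + ω * h3

-- Adding the finite triple product over `x = 1, ω, ω²` keeps only powers of `x` divisible by 3; the
-- term `x = 1` has product zero.
open Finset in
theorem sum_cubicAlpha {q : ℂ} (hq : ‖q‖ < 1) (hq0 : q ≠ 0) (n : ℕ) :
    ∑ p ∈ antidiagonal n, cubicAlpha q p.2 / (qPoch q q p.1 * qPoch q q (p.1 + 2 * p.2 + 3))
      = qPoch (q ^ 3) (q ^ 3) n / (qPoch q q n * qPoch q q (2 * n + 2)) := by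
  obtain ⟨ω, hω⟩ := exists_sq_add_self_add_one
  have h3 := pow_three_of_sq_add hω
  have hω0 : ω ≠ 0 := by rintro rfl; simp at hω
  have hi : ω⁻¹ = ω ^ 2 := inv_eq_of_mul_eq_one_right (by linear_combination h3)
  have hi2 : (ω ^ 2)⁻¹ = ω := by rw [← hi, inv_inv]
  have k0 := sum_finite_jacobi hq hq0 one_ne_zero n 2
  have k1 := sum_finite_jacobi hq hq0 hω0 n 2
  have k2 := sum_finite_jacobi hq hq0 (pow_ne_zero 2 hω0) n 2
  rw [hi] at k1
  rw [hi2] at k2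
  have hone : qPoch 1 q (n + 2 + 1) = 0 := by rw [qPoch_succ_left]; simp
  rw [hone, zero_mul, zero_div] at k0
  have hs : (∑ m ∈ range (n + 1), (1 + ω ^ m + (ω ^ 2) ^ m) * ((-1) ^ m * q ^ (m + 1).choose 2
          / (qPoch q q (n - m) * qPoch q q (n + m + 2 + 1))))
      + ∑ m ∈ range (n + 2 + 1), (1 + ω ^ (m + 1) + (ω ^ 2) ^ (m + 1))
          * ((-1) ^ (m + 1) * q ^ (m + 1).choose 2
          / (qPoch q q (n + m + 1) * qPoch q q (n + 2 - m)))
      = qPoch ω q (n + 2 + 1) * qPoch (q * ω ^ 2) q n / qPoch q q (2 * n + 2 + 1)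
        + qPoch (ω ^ 2) q (n + 2 + 1) * qPoch (q * ω) q n / qPoch q q (2 * n + 2 + 1) := by
    rw [← k1, ← k2]
    refine Eq.trans ?_ (zero_add _)
    rw [← k0]
    rw [show ∀ a b c d e f : ℂ, (a + b) + ((c + d) + (e + f)) = (a + c + e) + (b + d + f) from
        fun a b c d e f => by ring,
      ← sum_add_distrib, ← sum_add_distrib, ← sum_add_distrib, ← sum_add_distrib]
    simp only [inv_one, one_pow, mul_one]
    congr 1 <;> refine sum_congr rfl fun m _ => ?_ <;> ring
  -- Exponents 1 and 2 of the second sum are not multiples of 3. The rest, shifted, has exponent `m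
  -- + 3` and the same denominator as term `m` of the first sum; the two combine into the factor `1
  -- - q^(2m+3)`.
  rw [sum_range_succ' _ (n + 2), sum_range_succ' _ (n + 1)] at hs
  simp only [one_add_cube_root_pow hω] at hs
  rw [if_neg (show ¬ 3 ∣ 0 + 1 + 1 by norm_num), if_neg (show ¬ 3 ∣ 0 + 1 by norm_num), zero_mul,
    zero_mul, add_zero, add_zero] at hs
  rw [← Nat.sum_antidiagonal_swap, Nat.sum_antidiagonal_eq_sum_range_succ_mk]
  have hl : ∀ m ∈ range (n + 1), 3 * (cubicAlpha q m / (qPoch q q (n - m)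
        * qPoch q q (n - m + 2 * m + 3)))
      = (if 3 ∣ m then (3 : ℂ) else 0) * ((-1) ^ m * q ^ (m + 1).choose 2
          / (qPoch q q (n - m) * qPoch q q (n + m + 2 + 1)))
        + (if 3 ∣ m + 1 + 1 + 1 then (3 : ℂ) else 0) * ((-1) ^ (m + 1 + 1 + 1)
          * q ^ (m + 1 + 1 + 1).choose 2
          / (qPoch q q (n + (m + 1 + 1) + 1) * qPoch q q (n + 2 - (m + 1 + 1)))) := by
    intro m hm
    have hmn := mem_range.mp hm
    have hch : (m + 1 + 1 + 1).choose 2 = (m + 1).choose 2 + (2 * m + 3) := by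
      have := two_mul_choose_two (m + 1 + 1 + 1)
      have := two_mul_choose_two (m + 1)
      nlinarith
    rw [show n + 2 - (m + 1 + 1) = n - m by omega, hch,
      show n + (m + 1 + 1) + 1 = n + m + 2 + 1 by ring,
      show n - m + 2 * m + 3 = n + m + 2 + 1 by omega, cubicAlpha]
    by_cases h : 3 ∣ m
    · rw [if_pos h, if_pos h, if_pos (by omega)]; ring
    · rw [if_neg h, if_neg h, if_neg (by omega)]; ring
  have hS := (mul_sum (range (n + 1)) _ (3 : ℂ)).trans ((sum_congr rfl hl).trans
    (sum_add_distrib.trans hs))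
  rw [← mul_right_inj' (three_ne_zero : (3 : ℂ) ≠ 0)]
  refine hS.trans ?_
  have hP := qPoch_self_ne_zero hq
  have hu := one_sub_pow_succ_ne_zero hq (2 * n + 2)
  have h1 := hP n
  have h2 := hP (2 * n + 2)
  rw [← qPoch_mul_cube_roots hω, qPoch_self_succ]
  have hA : ∀ x : ℂ, qPoch x q (n + 2 + 1)
      = (1 - x) * (qPoch (x * q) q n * (1 - x * q ^ (n + 1)) * (1 - x * q ^ (n + 2))) := by
    intro x
    rw [qPoch_succ_left, qPoch_succ, qPoch_succ]; ring
  rw [hA, hA, mul_comm q, mul_comm q]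
  rw [show 2 * n + 2 + 1 = (n + 1) + (n + 2) by ring, pow_add q (n + 1)] at *
  generalize q ^ (n + 1) = u at *
  generalize q ^ (n + 2) = v at *
  generalize qPoch (ω * q) q n = A
  generalize qPoch (ω ^ 2 * q) q n = B
  field_simp
  -- `(1 - ω)(1 - ωu)(1 - ωv)` plus the same with `ω²` is `3(1 - uv)`, and `uv = q^(2n+3)` cancels
  -- the last factor of `(q;q)_{2n+3}`.
  linear_combination A * B * ((-(1 + u + v) + (u + v + u * v)) * hω
    + (ω * (u + v + u * v) - (ω ^ 3 + 2) * (u * v)) * h3)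

/-! ### Limits: the Jacobi triple product and Cauchy's identity. -/

open Filter Topology Finset in
/-- The Jacobi triple product, folded about its centre. -/
theorem tsum_jacobi {x y q : ℂ} (hx0 : x ≠ 0) (hy0 : y ≠ 0) (hx : ‖x‖ < 1) (hy : ‖y‖ < 1)
    (hq : q = x * y) :
    ∑' m : ℕ, (-1) ^ m * (x⁻¹ ^ m - x ^ (m + 1)) * q ^ (m + 1).choose 2
      = qPochInf x q * qPochInf y q * qPochInf q q := by
  have hq1 : ‖q‖ < 1 := by
    rw [hq, norm_mul]; exact mul_lt_one_of_nonneg_of_lt_one_left (norm_nonneg x) hx hy.le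
  have hq0 : q ≠ 0 := by rw [hq]; exact mul_ne_zero hx0 hy0
  have hyx : q * x⁻¹ = y := by rw [hq]; field_simp
  set T : ℕ → ℂ := fun m => (-1) ^ m * (x⁻¹ ^ m - x ^ (m + 1)) * q ^ (m + 1).choose 2 with hT
  obtain ⟨K, hK0, hK⟩ := exists_norm_inv_qPoch_le hq1
  -- The growth of `x⁻¹ ^ m` is absorbed by one factor `q^m`, as `q x⁻¹ = y`.
  have hTb : ∀ m, ‖T m‖ ≤ ‖y‖ ^ m + ‖x‖ ^ m := by
    intro m
    have e : T m = (-1) ^ m * (y ^ m * q ^ m.choose 2)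
        - (-1) ^ m * (x ^ m * (x * q ^ (m + 1).choose 2)) := by
      have : q ^ (m + 1).choose 2 = q ^ m * q ^ m.choose 2 := by
        rw [Nat.choose_succ_succ' m 1, Nat.choose_one_right, pow_add]
      rw [hT, ← hyx, mul_pow]
      simp only []
      rw [mul_right_comm (q ^ m), ← this]
      ring
    rw [e]
    refine (norm_sub_le _ _).trans (add_le_add ?_ ?_)
    · simp only [norm_mul, norm_pow, norm_neg, norm_one, one_pow, one_mul]
      exact mul_le_of_le_one_right (by positivity) (pow_le_one₀ (norm_nonneg _) hq1.le)
    · simp only [norm_mul, norm_pow, norm_neg, norm_one, one_pow, one_mul]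
      exact mul_le_of_le_one_right (by positivity)
        (mul_le_one₀ hx.le (by positivity) (pow_le_one₀ (norm_nonneg _) hq1.le))
  have hQ := tendsto_qPoch q hq1
  have hQ0 := qPochInf_self_ne_zero hq1
  have hlim := tendsto_tsum_of_dominated_convergence (𝓕 := atTop)
    (f := fun n m => if m ≤ n then T m * (qPoch q q (n - m))⁻¹ * (qPoch q q (n + m + 1))⁻¹ else 0)
    (g := fun m => T m * (qPochInf q q)⁻¹ * (qPochInf q q)⁻¹)
    (bound := fun m => (‖y‖ ^ m + ‖x‖ ^ m) * K * K)
    ((((summable_geometric_of_lt_one (norm_nonneg y) hy).add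
      (summable_geometric_of_lt_one (norm_nonneg x) hx)).mul_right K).mul_right K)
    (by
      intro m
      have h1 := (hQ.comp (tendsto_sub_atTop_nat m)).inv₀ hQ0
      have h2 := (hQ.comp (tendsto_add_atTop_nat (m + 1))).inv₀ hQ0
      refine ((h1.const_mul (T m)).mul h2).congr' ?_
      filter_upwards [eventually_ge_atTop m] with n hn
      simp [hn, add_assoc])
    (by
      refine Eventually.of_forall fun n m => ?_
      split_ifs
      · rw [norm_mul, norm_mul]
        exact mul_le_mul (mul_le_mul (hTb m) (hK _) (norm_nonneg _) (by positivity)) (hK _)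
          (norm_nonneg _) (by positivity)
      · rw [norm_zero]; positivity)
  have hfin : ∀ n, ∑' m, (if m ≤ n then T m * (qPoch q q (n - m))⁻¹ * (qPoch q q (n + m + 1))⁻¹
      else 0) = qPoch x q (n + 1) * qPoch y q n * (qPoch q q (2 * n + 1))⁻¹ := by
    intro n
    have h := sum_finite_jacobi hq1 hq0 hx0 n 0
    rw [hyx] at h
    simp only [add_zero] at h
    rw [← div_eq_mul_inv, ← h, ← sum_add_distrib, tsum_eq_sum (s := range (n + 1))
      (fun m hm => if_neg (by simpa [Nat.lt_succ_iff] using hm))]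
    refine sum_congr rfl fun m hm => ?_
    rw [if_pos (Nat.lt_succ_iff.mp (mem_range.mp hm)), hT]
    ring
  simp only [hfin] at hlim
  have hx' := (tendsto_qPoch x hq1).comp (tendsto_add_atTop_nat 1)
  have hodd : Tendsto (fun n : ℕ => 2 * n + 1) atTop atTop :=
    tendsto_atTop_mono (fun n => by simp only [id]; omega) tendsto_id
  have hlim2 := (hx'.mul (tendsto_qPoch y hq1)).mul ((hQ.comp hodd).inv₀ hQ0)
  have := tendsto_nhds_unique hlim hlim2
  rw [tsum_mul_right, tsum_mul_right] at this
  field_simp at this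
  exact this.trans (by ring)

open Filter Topology Finset in
/-- Cauchy's Durfee rectangle identity. -/
theorem tsum_durfee {q : ℂ} (hq : ‖q‖ < 1) (hq0 : q ≠ 0) (k : ℕ) :
    ∑' t : ℕ, q ^ (t ^ 2 + k * t) / (qPoch q q t * qPoch q q (t + k)) = (qPochInf q q)⁻¹ := by
  have hq3 := norm_pow_lt_one hq three_ne_zero
  obtain ⟨K, hK0, hK⟩ := exists_norm_inv_qPoch_le hq
  obtain ⟨L, hL0, hL⟩ := exists_norm_inv_qPoch_le hq3
  obtain ⟨B, hB0, hB⟩ := exists_norm_qPoch_le q hq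
  have hQ := tendsto_qPoch q hq
  have hQ0 := qPochInf_self_ne_zero hq
  have hR := tendsto_qPoch (q ^ 3) hq3
  have hR0 := qPochInf_self_ne_zero hq3
  -- Cauchy's identity is the limit `M → ∞` of `sum_cubic`: the base `q³` factors tend to
  -- `1/(q³;q³)_∞` on both sides and cancel.
  have hlim := tendsto_tsum_of_dominated_convergence (𝓕 := atTop)
    (f := fun n t => if t ≤ n then q ^ (t ^ 2 + k * t) * (qPoch q q t)⁻¹ * (qPoch q q (t + k))⁻¹
      * qPoch q q (3 * (n - t) + 2 * t + k) * (qPoch (q ^ 3) (q ^ 3) (n - t))⁻¹ else 0)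
    (g := fun t => q ^ (t ^ 2 + k * t) * (qPoch q q t)⁻¹ * (qPoch q q (t + k))⁻¹
      * qPochInf q q * (qPochInf (q ^ 3) (q ^ 3))⁻¹)
    (bound := fun t => ‖q‖ ^ t * K * K * B * L)
    (((((summable_geometric_of_lt_one (norm_nonneg q) hq).mul_right K).mul_right K).mul_right
      B).mul_right L)
    (by
      intro t
      have h1 := (hR.comp (tendsto_sub_atTop_nat t)).inv₀ hR0
      have h3 : Tendsto (fun n => 3 * (n - t) + 2 * t + k) atTop atTop :=
        tendsto_atTop_mono (fun n => by simp only [id]; omega) tendsto_id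
      have h2 := hQ.comp h3
      refine ((h2.const_mul _).mul h1).congr' ?_
      filter_upwards [eventually_ge_atTop t] with n hn
      simp [hn])
    (by
      refine Eventually.of_forall fun n t => ?_
      split_ifs
      · simp only [norm_mul]
        have hqt : ‖q ^ (t ^ 2 + k * t)‖ ≤ ‖q‖ ^ t := by
          rw [norm_pow]
          exact pow_le_pow_of_le_one (norm_nonneg _) hq.le (by nlinarith [Nat.le_self_pow two_ne_zero t])
        have := hK t
        have := hK (t + k)
        have := hB (3 * (n - t) + 2 * t + k)
        have := hL (n - t)
        gcongr
      · rw [norm_zero]; positivity)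
  have hfin : ∀ n, ∑' t, (if t ≤ n then q ^ (t ^ 2 + k * t) * (qPoch q q t)⁻¹
      * (qPoch q q (t + k))⁻¹ * qPoch q q (3 * (n - t) + 2 * t + k)
      * (qPoch (q ^ 3) (q ^ 3) (n - t))⁻¹ else 0)
      = qPoch (q ^ 3) (q ^ 3) (2 * n + k) * ((qPoch (q ^ 3) (q ^ 3) n)⁻¹
        * (qPoch (q ^ 3) (q ^ 3) (n + k))⁻¹) := by
    intro n
    have h := sum_cubic hq hq0 k n
    rw [← Nat.sum_antidiagonal_swap, Nat.sum_antidiagonal_eq_sum_range_succ_mk] at h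
    rw [← mul_inv, ← div_eq_mul_inv, ← h, tsum_eq_sum (s := range (n + 1))
      (fun m hm => if_neg (by simpa [Nat.lt_succ_iff] using hm))]
    refine sum_congr rfl fun m hm => ?_
    rw [if_pos (Nat.lt_succ_iff.mp (mem_range.mp hm))]
    simp only [Prod.fst_swap, Prod.snd_swap]
    rw [div_eq_mul_inv, mul_inv, mul_inv]
    ring
  simp only [hfin] at hlim
  have h2n : Tendsto (fun n : ℕ => 2 * n + k) atTop atTop :=
    tendsto_atTop_mono (fun n => by simp only [id]; omega) tendsto_id
  have hlim2 := (hR.comp h2n).mul ((hR.inv₀ hR0).mul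
    ((hR.comp (tendsto_add_atTop_nat k)).inv₀ hR0))
  have := tendsto_nhds_unique hlim hlim2
  rw [tsum_mul_right, tsum_mul_right, mul_inv_cancel_left₀ hR0] at this
  simp only [div_eq_mul_inv, mul_inv, ← mul_assoc]
  refine eq_inv_of_mul_eq_one_left ?_
  exact mul_right_cancel₀ (inv_ne_zero hR0) (this.trans (one_mul _).symm)

/-! ### The theta series, the change of base and the final summation. -/

theorem norm_cubicAlpha_le {q : ℂ} (hq : ‖q‖ < 1) (m : ℕ) : ‖cubicAlpha q m‖ ≤ 2 := by
  have h1 : ∀ k, ‖q‖ ^ k ≤ 1 := fun k => pow_le_one₀ (norm_nonneg _) hq.le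
  rw [cubicAlpha]
  split_ifs
  · simp only [norm_mul, norm_pow, norm_neg, norm_one, one_pow, one_mul]
    have h2 : ‖1 - q ^ (2 * m + 3)‖ ≤ 2 := by
      refine (norm_sub_le _ _).trans ?_
      rw [norm_one, norm_pow]
      linarith [h1 (2 * m + 3)]
    calc _ ≤ (1 : ℝ) * 2 := mul_le_mul (h1 _) h2 (norm_nonneg _) zero_le_one
      _ = 2 := one_mul 2
  · simp

theorem tsum_cubicAlpha {q : ℂ} (hq : ‖q‖ < 1) (hq0 : q ≠ 0) :
    ∑' m, cubicAlpha q m * q ^ (4 * m ^ 2 + 12 * m)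
      = qPochInf (q ^ 3) (q ^ 81) * qPochInf (q ^ 78) (q ^ 81) * qPochInf (q ^ 81) (q ^ 81) := by
  rw [← tsum_jacobi (pow_ne_zero 3 hq0) (pow_ne_zero 78 hq0) (norm_pow_lt_one hq (by norm_num))
    (norm_pow_lt_one hq (by norm_num)) (by rw [← pow_add])]
  have hinj : Function.Injective fun k : ℕ => 3 * k := fun a b h => by simpa using h
  rw [← hinj.tsum_eq (fun m hm => by
    by_contra h
    have h3 : ¬ 3 ∣ m := fun ⟨k, hk⟩ => h ⟨k, hk.symm⟩
    exact hm (by simp [cubicAlpha, h3]))]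
  refine tsum_congr fun k => ?_
  rw [cubicAlpha, if_pos ⟨k, rfl⟩, inv_pow, ← pow_mul, ← pow_mul, ← pow_mul]
  have hs : (-1 : ℂ) ^ (3 * k) = (-1) ^ k := by rw [pow_mul]; norm_num
  have hk : q ^ (3 * k) ≠ 0 := pow_ne_zero _ hq0
  -- With `m = 3k` the exponents match the triple product at `x = q³`, `y = q^78`; the extra `3k`
  -- accounts for `x⁻¹ ^ k`.
  have he : (3 * k + 1).choose 2 + (4 * (3 * k) ^ 2 + 12 * (3 * k)) + 3 * k
      = 81 * (k + 1).choose 2 := by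
    have := two_mul_choose_two (3 * k + 1)
    have := two_mul_choose_two (k + 1)
    nlinarith
  have h2 : 3 * (k + 1) = 3 * k + 3 := by ring
  rw [hs, ← he, pow_add _ _ (3 * k), pow_add q (Nat.choose _ _), h2,
    show 2 * (3 * k) + 3 = 3 * k + (3 * k + 3) by ring, pow_add q (3 * k) (3 * k + 3)]
  field_simp

open Finset in
theorem sum_antidiagonal_cubic_change_of_base {q : ℂ} (hq : ‖q‖ < 1) (hq0 : q ≠ 0) (N : ℕ) :
    ∑ p ∈ antidiagonal N,
        q ^ (3 * p.1 ^ 2 + 4 * p.2 ^ 2 + 6 * p.1 * p.2 + 9 * p.1 + 12 * p.2)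
            * qPoch (q ^ 3) (q ^ 3) p.2 * qPoch q q (3 * p.1 + 2 * p.2 + 3)
          / (qPoch (q ^ 3) (q ^ 3) (2 * p.1 + 2 * p.2 + 3) * qPoch q q p.2
            * qPoch q q (2 * p.2 + 2) * qPoch (q ^ 3) (q ^ 3) p.1)
      = ∑ p ∈ antidiagonal N, (q ^ 3) ^ ((p.1 + p.2) ^ 2 + 3 * (p.1 + p.2))
          * (cubicAlpha q p.2 * q ^ (p.2 ^ 2 + 3 * p.2))
          / (qPoch (q ^ 3) (q ^ 3) p.1 * qPoch (q ^ 3) (q ^ 3) (p.1 + (2 * p.2 + 3))) := by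
  have hQ := qPoch_self_ne_zero (norm_pow_lt_one hq three_ne_zero)
  -- Everything that depends only on `n + r = N`, hence constant on the antidiagonal.
  set c := (q ^ 3) ^ (N ^ 2 + 3 * N) / qPoch (q ^ 3) (q ^ 3) (2 * N + 3) with hc
  have hL : ∀ p ∈ antidiagonal N,
      q ^ (3 * p.1 ^ 2 + 4 * p.2 ^ 2 + 6 * p.1 * p.2 + 9 * p.1 + 12 * p.2)
            * qPoch (q ^ 3) (q ^ 3) p.2 * qPoch q q (3 * p.1 + 2 * p.2 + 3)
          / (qPoch (q ^ 3) (q ^ 3) (2 * p.1 + 2 * p.2 + 3) * qPoch q q p.2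
            * qPoch q q (2 * p.2 + 2) * qPoch (q ^ 3) (q ^ 3) p.1)
      = ∑ x ∈ antidiagonal p.2, c * (cubicAlpha q x.2 * q ^ (x.2 ^ 2 + 3 * x.2)) *
          (q ^ (x.1 ^ 2 + (2 * x.2 + 3) * x.1) * qPoch q q (3 * p.1 + 2 * x.1 + (2 * x.2 + 3))
            / (qPoch (q ^ 3) (q ^ 3) p.1 * qPoch q q x.1 * qPoch q q (x.1 + (2 * x.2 + 3)))) := by
    intro p hp
    have hN := mem_antidiagonal.mp hp
    have hx : ∀ x ∈ antidiagonal p.2, c * (cubicAlpha q x.2 * q ^ (x.2 ^ 2 + 3 * x.2)) *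
          (q ^ (x.1 ^ 2 + (2 * x.2 + 3) * x.1) * qPoch q q (3 * p.1 + 2 * x.1 + (2 * x.2 + 3))
            / (qPoch (q ^ 3) (q ^ 3) p.1 * qPoch q q x.1 * qPoch q q (x.1 + (2 * x.2 + 3))))
        = c * q ^ (p.2 ^ 2 + 3 * p.2) * qPoch q q (3 * p.1 + 2 * p.2 + 3)
            / qPoch (q ^ 3) (q ^ 3) p.1
          * (cubicAlpha q x.2 / (qPoch q q x.1 * qPoch q q (x.1 + 2 * x.2 + 3))) := by
      intro x hx
      rw [← mem_antidiagonal.mp hx, show (x.1 + x.2) ^ 2 + 3 * (x.1 + x.2)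
        = (x.2 ^ 2 + 3 * x.2) + (x.1 ^ 2 + (2 * x.2 + 3) * x.1) by ring, pow_add q,
        show 3 * p.1 + 2 * (x.1 + x.2) + 3 = 3 * p.1 + 2 * x.1 + (2 * x.2 + 3) by ring,
        ← add_assoc x.1]
      simp only [div_eq_mul_inv, mul_inv]
      ring
    rw [sum_congr rfl hx, ← mul_sum, sum_cubicAlpha hq hq0, hc,
      show 2 * N + 3 = 2 * p.1 + 2 * p.2 + 3 by omega, ← hN, ← pow_mul]
    rw [show 3 * p.1 ^ 2 + 4 * p.2 ^ 2 + 6 * p.1 * p.2 + 9 * p.1 + 12 * p.2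
      = 3 * ((p.1 + p.2) ^ 2 + 3 * (p.1 + p.2)) + (p.2 ^ 2 + 3 * p.2) by ring, pow_add q]
    simp only [div_eq_mul_inv, mul_inv]
    ring
  rw [sum_congr rfl hL, sum_antidiagonal_assoc (fun n t m =>
    c * (cubicAlpha q m * q ^ (m ^ 2 + 3 * m)) *
          (q ^ (t ^ 2 + (2 * m + 3) * t) * qPoch q q (3 * n + 2 * t + (2 * m + 3))
            / (qPoch (q ^ 3) (q ^ 3) n * qPoch q q t * qPoch q q (t + (2 * m + 3)))))]
  refine sum_congr rfl fun p hp => ?_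
  have hN := mem_antidiagonal.mp hp
  rw [← mul_sum, sum_cubic hq hq0, hc, hN, show 2 * p.1 + (2 * p.2 + 3) = 2 * N + 3 by omega]
  have := hQ (2 * N + 3)
  field_simp

theorem mainTheorem9 (q : ℂ) (hq : ‖q‖ < 1) :
    HasSum
      (fun p : ℕ × ℕ =>
        q ^ (3 * p.1 ^ 2 + 4 * p.2 ^ 2 + 6 * p.1 * p.2 + 9 * p.1 + 12 * p.2)
            * qPoch (q ^ 3) (q ^ 3) p.2 * qPoch q q (3 * p.1 + 2 * p.2 + 3)
          / (qPoch (q ^ 3) (q ^ 3) (2 * p.1 + 2 * p.2 + 3) * qPoch q q p.2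
            * qPoch q q (2 * p.2 + 2) * qPoch (q ^ 3) (q ^ 3) p.1))
      (qPochInf (q ^ 3) (q ^ 81) * qPochInf (q ^ 78) (q ^ 81) * qPochInf (q ^ 81) (q ^ 81)
        / qPochInf (q ^ 3) (q ^ 3)) := by
  -- The argument divides by powers of `q`. At `q = 0` only the term `(0, 0)` survives, and both
  -- sides are 1.
  rcases eq_or_ne q 0 with rfl | hq0
  · have h := hasSum_single (f := fun p : ℕ × ℕ =>
        (0 : ℂ) ^ (3 * p.1 ^ 2 + 4 * p.2 ^ 2 + 6 * p.1 * p.2 + 9 * p.1 + 12 * p.2)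
            * qPoch (0 ^ 3) (0 ^ 3) p.2 * qPoch 0 0 (3 * p.1 + 2 * p.2 + 3)
          / (qPoch (0 ^ 3) (0 ^ 3) (2 * p.1 + 2 * p.2 + 3) * qPoch 0 0 p.2
            * qPoch 0 0 (2 * p.2 + 2) * qPoch (0 ^ 3) (0 ^ 3) p.1)) (0, 0) (by
      rintro ⟨n, r⟩ h
      have h' : ¬ (n = 0 ∧ r = 0) := fun ⟨h1, h2⟩ => h (by rw [h1, h2])
      simp only
      rw [zero_pow (by omega)]
      simp)
    simpa [qPochInf, qPoch] using h
  have hq3 := norm_pow_lt_one hq three_ne_zero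
  have hq30 : q ^ 3 ≠ 0 := pow_ne_zero 3 hq0
  obtain ⟨K, hK0, hK⟩ := exists_norm_inv_qPoch_le hq
  obtain ⟨L, hL0, hL⟩ := exists_norm_inv_qPoch_le hq3
  obtain ⟨B, hB0, hB⟩ := exists_norm_qPoch_le q hq
  obtain ⟨A, hA0, hA⟩ := exists_norm_qPoch_le (q ^ 3) hq3
  have hpow : ∀ {a b : ℕ}, a ≤ b → ‖q ^ b‖ ≤ ‖q‖ ^ a := fun h => by
    rw [norm_pow]; exact pow_le_pow_of_le_one (norm_nonneg _) hq.le h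
  have hf := summable_prod_of_norm_le_pow (norm_nonneg q) hq
    (f := fun p : ℕ × ℕ =>
        q ^ (3 * p.1 ^ 2 + 4 * p.2 ^ 2 + 6 * p.1 * p.2 + 9 * p.1 + 12 * p.2)
            * qPoch (q ^ 3) (q ^ 3) p.2 * qPoch q q (3 * p.1 + 2 * p.2 + 3)
          / (qPoch (q ^ 3) (q ^ 3) (2 * p.1 + 2 * p.2 + 3) * qPoch q q p.2
            * qPoch q q (2 * p.2 + 2) * qPoch (q ^ 3) (q ^ 3) p.1))
    (C := A * B * (L * K * K * L)) (by
      intro p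
      simp only [div_eq_mul_inv, mul_inv, norm_mul]
      -- The exponent is at least `n + r` and all other factors are bounded, so a geometric double
      -- series dominates.
      have h1 := hpow (a := p.1 + p.2)
        (b := 3 * p.1 ^ 2 + 4 * p.2 ^ 2 + 6 * p.1 * p.2 + 9 * p.1 + 12 * p.2) (by nlinarith)
      have h2 := hA p.2
      have h3 := hB (3 * p.1 + 2 * p.2 + 3)
      have h4 := hL (2 * p.1 + 2 * p.2 + 3)
      have h5 := hK p.2
      have h6 := hK (2 * p.2 + 2)
      have h7 := hL p.1
      calc _ ≤ ‖q‖ ^ (p.1 + p.2) * A * B * (L * K * K * L) := by gcongr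
        _ = _ := by ring)
  have hg := summable_prod_of_norm_le_pow (norm_nonneg q) hq
    (f := fun p : ℕ × ℕ => (q ^ 3) ^ ((p.1 + p.2) ^ 2 + 3 * (p.1 + p.2))
          * (cubicAlpha q p.2 * q ^ (p.2 ^ 2 + 3 * p.2))
          / (qPoch (q ^ 3) (q ^ 3) p.1 * qPoch (q ^ 3) (q ^ 3) (p.1 + (2 * p.2 + 3))))
    (C := 2 * (L * L)) (by
      intro p
      simp only [div_eq_mul_inv, mul_inv, norm_mul, ← pow_mul]
      have h1 := hpow (a := p.1 + p.2)
        (b := 3 * ((p.1 + p.2) ^ 2 + 3 * (p.1 + p.2))) (by nlinarith)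
      have h2 := hpow (Nat.zero_le (p.2 ^ 2 + 3 * p.2))
      have h3 := norm_cubicAlpha_le hq p.2
      have h4 := hL p.1
      have h5 := hL (p.1 + (2 * p.2 + 3))
      calc _ ≤ ‖q‖ ^ (p.1 + p.2) * (2 * ‖q‖ ^ 0) * (L * L) := by gcongr
        _ = _ := by ring)
  rw [hf.hasSum_iff, tsum_eq_of_sum_antidiagonal_eq hf hg
    (sum_antidiagonal_cubic_change_of_base hq hq0), ← (Equiv.prodComm ℕ ℕ).tsum_eq]
  refine ((Equiv.prodComm ℕ ℕ).summable_iff.mpr hg).tsum_prod.trans ?_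
  rw [← tsum_cubicAlpha hq hq0, div_eq_mul_inv, ← tsum_mul_right]
  refine tsum_congr fun m => ?_
  rw [← tsum_durfee hq3 hq30 (2 * m + 3), ← tsum_mul_left]
  refine tsum_congr fun s => ?_
  simp only [Function.comp_apply, Equiv.prodComm_apply, Prod.swap_prod_mk]
  -- The exponent separates into a function of `m` and the Durfee exponent for `k = 2m + 3`.
  rw [show (s + m) ^ 2 + 3 * (s + m) = (m ^ 2 + 3 * m) + (s ^ 2 + (2 * m + 3) * s) by ring,
    pow_add (q ^ 3), ← pow_mul q 3 (m ^ 2 + 3 * m),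
    show 4 * m ^ 2 + 12 * m = 3 * (m ^ 2 + 3 * m) + (m ^ 2 + 3 * m) by ring, pow_add q]
  ring
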